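/- Let $n\ge 2$ and let $S^{n-1}\subset\mathbb R^n$ be the unit sphere. A finite non-empty set $Y\subset S^{n-1}$ is a \emph{spherical design of harmonic index $T$} ($T$ a set of positive integers) if $\sum_{x\in Y}f(x)=0$ for every real homogeneous harmonic polynomial $f$ in $n$ variables of degree $k\in T$. Put $I(Y)=\{x\cdot y: x,y\in Y,\ x\ne y\}$. Let $Q_{n,k}$ be the Gegenbauer polynomials normalised by $Q_{n,k}(1)=\binom{n+k-1}{n-1}-\binom{n+k-3}{n-1}$, i.e. $Q_{n,0}=1$, $Q_{n,1}(x)=nx$, $\lambda_{k+1}Q_{n,k+1}=xQ_{n,k}-(1-\lambda_{k-1})Q_{n,k-1}$ with $\lambda_0=0$ and $\lambda_k=k/(n+2k-2)$ for $k\ge1$. For $T=\{t_1>\dots>t_\ell\}$ with $t_1$ even, consider $L=Q_{n,t_1}+\sum_{i\ge2}f_{t_i}Q_{n,t_i}$ with real coefficients such that the minimum of $L$ over $[-1,1]$ is attained at exactly $\ell$ non-negative points. If such coefficients exist and are unique, put $c_{n,T}=-\min_{[-1,1]}L$, $F=c_{n,T}+L$ and $b_{n,T}=F(1)/c_{n,T}$;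 a design $Y$ of harmonic index $T$ is called \emph{tight} if $|Y|=b_{n,T}$. Let $T=\{6,2\}$. Then the following hold. (a) For $n\ge 3$ there is no tight spherical design of harmonic index $\{6,2\}$ on $S^{n-1}$. (b) For $n=2$, $Y=\{(1,0),(0,1)\}$ is a tight spherical design of harmonic index $\{6,2\}$. (c) For every $n\ge2$ the coefficient $f_2$ exists and is unique, and $$f_2=\frac{(n-2)(n+4)(n+10)}{32(n+8)},\quad c_{n,T}=\frac{(n+2)(n+6)(n+10)(7n-4)}{192(n+8)},\quad b_{n,T}=\frac{n(n+4)(2n+1)^2}{15(7n-4)};$$ the minimum of $L$ over $[-1,1]$ is attained exactly at $0$ and $\pm\alpha$, where $\alpha=\sqrt{15/(2(n+8))}$. Every design $Y$ of harmonic index $\{6,2\}$ on $S^{n-1}$ satisfies $|Y|\ge b_{n,T}$, and it is tight if and only if $I(Y)\subseteq\{0,\alpha,-\alpha\}$. (d) For $n\ge 8817$, $b_{n,T}$ is not an integer. (e) If $Y$ is a finite set of unit vectors in $\mathbb R^n$ with $I(Y)\subseteq\{0,\beta,-\beta\}$ for some real $\beta\ne0$ and $|Y|>2n$, then $1/\beta$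 is an integer. For $5\le n\le 8816$ one has $b_{n,T}>2n$ (so that for a tight design $1/\alpha=\sqrt{2(n+8)/15}$ would have to be an integer), but $\sqrt{2(n+8)/15}$ and $b_{n,T}$ are not both integers. -/

import Mathlib

namespace HarmonicIndex

open Polynomial

/-- The normalising ratio `λ_k = k / (n + 2k - 2)` of the Gegenbauer recurrence (`λ_0 = 0`). -/
noncomputable def gegenbauerRatio (n k : ℕ) : ℝ := (k : ℝ) / ((n : ℝ) + 2 * (k : ℝ) - 2)

/-- The Gegenbauer polynomials `Q_{n,k}` in the normalisation of Delsarte, Goethals and Seidel, for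
which `Q_{n,k}(1)` is the dimension of the space of harmonic forms of degree `k` in `n` variables:
`Q_{n,0} = 1`, `Q_{n,1} = n x`, and
`λ_{k+1} Q_{n,k+1} = x Q_{n,k} - (1 - λ_{k-1}) Q_{n,k-1}`. -/
noncomputable def gegenbauer (n : ℕ) : ℕ → ℝ[X]
  | 0 => 1
  | 1 => C (n : ℝ) * X
  | k + 2 => C (gegenbauerRatio n (k + 2))⁻¹ *
      (X * gegenbauer n (k + 1) - C (1 - gegenbauerRatio n k) * gegenbauer n k)

/-- `f` is a homogeneous harmonic polynomial of degree `k` in `n` variables. -/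
def IsHarmonicForm (n k : ℕ) (f : MvPolynomial (Fin n) ℝ) : Prop :=
  f.IsHomogeneous k ∧ ∑ i, MvPolynomial.pderiv i (MvPolynomial.pderiv i f) = 0

/-- `Y` is a spherical design of harmonic index `T`: a non-empty finite subset of the unit sphere
of `ℝⁿ` over which every harmonic form of degree `k ∈ T` sums to zero. -/
def IsDesign (n : ℕ) (T : Set ℕ) (Y : Finset (EuclideanSpace ℝ (Fin n))) : Prop :=
  Y.Nonempty ∧ (∀ x ∈ Y, ‖x‖ = 1) ∧
    ∀ k ∈ T, ∀ f : MvPolynomial (Fin n) ℝ, IsHarmonicForm n k f →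
      ∑ x ∈ Y, MvPolynomial.eval (fun i => x i) f = 0

/-- The set `I(Y)` of inner products of distinct points of `Y`. -/
def innerProducts {n : ℕ} (Y : Finset (EuclideanSpace ℝ (Fin n))) : Set ℝ :=
  {r | ∃ x ∈ Y, ∃ y ∈ Y, x ≠ y ∧ inner ℝ x y = r}

/-- The combination `L = ∑_{t ∈ T} f_t Q_{n,t}`. -/
noncomputable def testPolynomial (n : ℕ) (T : Finset ℕ) (f : ℕ → ℝ) : ℝ[X] :=
  ∑ t ∈ T, C (f t) * gegenbauer n t

/-- `f` is a family of coefficients for the Fisher type bound of index `T`, where `T` has `ℓ`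
elements of which the largest is even: the leading coefficient is `1`, there are no coefficients
outside `T`, and `L` attains its minimum over `[-1, 1]` at exactly `ℓ` non-negative points. -/
def IsFisherFamily (n : ℕ) (T : Finset ℕ) (f : ℕ → ℝ) : Prop :=
  T.Nonempty ∧ Even (T.sup id) ∧ f (T.sup id) = 1 ∧ (∀ t, t ∉ T → f t = 0) ∧
    {x : ℝ | 0 ≤ x ∧ x ≤ 1 ∧
      IsMinOn (fun u : ℝ => (testPolynomial n T f).eval u) (Set.Icc (-1) 1) x}.ncard = T.card

/-- `c` is the number `c_{n,T} = - min_{[-1,1]} L` for the combination `L` with coefficients `f`. -/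
def IsNegMin (n : ℕ) (T : Finset ℕ) (f : ℕ → ℝ) (c : ℝ) : Prop :=
  IsLeast ((fun u : ℝ => (testPolynomial n T f).eval u) '' Set.Icc (-1) 1) (-c)

/-- `b` is the Fisher type bound `b_{n,T} = F(1) / c_{n,T}`, where `F = c_{n,T} + L` and `L` is the
combination with the uniquely determined coefficients. -/
def IsFisherBound (n : ℕ) (T : Finset ℕ) (b : ℝ) : Prop :=
  ∃ f : ℕ → ℝ, IsFisherFamily n T f ∧ (∀ g, IsFisherFamily n T g → g = f) ∧
    ∃ c : ℝ, 0 < c ∧ IsNegMin n T f c ∧ b = (c + (testPolynomial n T f).eval 1) / c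

/-- `Y` is a tight spherical design of harmonic index `T`: a design whose size is the Fisher type
bound. -/
def IsTightDesign (n : ℕ) (T : Finset ℕ) (Y : Finset (EuclideanSpace ℝ (Fin n))) : Prop :=
  IsDesign n (T : Set ℕ) Y ∧ IsFisherBound n T (Y.card : ℝ)

end HarmonicIndex

/-! Write `a = zeroSq n`. Since only even powers occur, `L` is a cubic in `u = x²`. For the right
coefficient of `Q_{n,2}` it equals `A u (u - a)² - c`, with `A = leadSix n` and `c = negMin n`; its
minimum is attained at the double root `u = a` and at the endpoint `u = 0`. Any other coefficient
adds a nonzero linear term in `u` and destroys one of the two minima (`IsFisherFamily.apply_two`).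

Zonal harmonics of degrees 2 and 6 make both Gegenbauer sums over a design vanish. Summing `F = c +
L` over all pairs then gives `|Y| (|Y| - b) c` as a sum of nonnegative off-diagonal terms
(`IsDesign.card_mul_sub`). This yields the bound, and equality means that every inner product is a
zero of `F`.

For nonexistence with `n ≥ 5`, a tight design has more than `2n` points, so an eigenvalue argument
on its Gram matrix makes `1/√a` an integer (`exists_int_one_div_of_two_mul_lt_card`). That and the
integrality of `b` are incompatible, because `7n - 4` must divide 28800
(`not_sqrt_int_and_fisherBound_int`). For `n = 3, 4` the bound itself is not an integer. -/

namespace HarmonicIndex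

open Polynomial

/-! ### Gegenbauer polynomials, the extremal combination and the value of the bound. -/

theorem gegenbauer_two_eval {n : ℕ} (hn : 2 ≤ n) (x : ℝ) :
    (gegenbauer n 2).eval x = ((n : ℝ) + 2) / 2 * (n * x ^ 2 - 1) := by
  have h : (2 : ℝ) ≤ n := by exact_mod_cast hn
  simp only [gegenbauer, gegenbauerRatio, eval_mul, eval_sub, eval_C, eval_X, eval_one]
  push_cast
  norm_num
  field_simp
  ring

theorem gegenbauer_six_eval {n : ℕ} (hn : 2 ≤ n) (x : ℝ) :
    (gegenbauer n 6).eval x = (n : ℝ) * (n + 2) * (n + 10) / 720 *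
      ((n + 4) * (n + 6) * (n + 8) * x ^ 6 - 15 * (n + 4) * (n + 6) * x ^ 4
        + 45 * (n + 4) * x ^ 2 - 15) := by
  have h : (2 : ℝ) ≤ n := by exact_mod_cast hn
  have h1 : (gegenbauer n 1).eval x = n * x := by simp [gegenbauer]
  have h3 : (gegenbauer n 3).eval x =
      (n : ℝ) * (n + 4) / 6 * ((n + 2) * x ^ 3 - 3 * x) := by
    rw [gegenbauer]
    simp only [Nat.reduceAdd, gegenbauer_two_eval hn, h1, gegenbauerRatio, eval_mul, eval_sub,
      eval_C, eval_X]
    have e1 : (n : ℝ) + 2 * 3 - 2 = n + 4 := by ring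
    have e2 : (n : ℝ) + 2 * 1 - 2 = n := by ring
    push_cast
    rw [e1, e2]
    field_simp
    ring
  have h4 : (gegenbauer n 4).eval x = (n : ℝ) * (n + 6) / 24 *
      ((n + 2) * (n + 4) * x ^ 4 - 6 * (n + 2) * x ^ 2 + 3) := by
    rw [gegenbauer]
    simp only [gegenbauer_two_eval hn, h3, gegenbauerRatio, eval_mul, eval_sub, eval_C, eval_X]
    have e1 : (n : ℝ) + 2 * 4 - 2 = n + 6 := by ring
    have e2 : (n : ℝ) + 2 * 2 - 2 = n + 2 := by ring
    push_cast
    rw [e1, e2]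
    field_simp
    ring
  have h5 : (gegenbauer n 5).eval x = (n : ℝ) * (n + 2) * (n + 8) / 120 *
      ((n + 4) * (n + 6) * x ^ 5 - 10 * (n + 4) * x ^ 3 + 15 * x) := by
    rw [gegenbauer]
    simp only [h4, h3, gegenbauerRatio, eval_mul, eval_sub, eval_C, eval_X]
    have e1 : (n : ℝ) + 2 * 5 - 2 = n + 8 := by ring
    have e2 : (n : ℝ) + 2 * 3 - 2 = n + 4 := by ring
    push_cast
    rw [e1, e2]
    field_simp
    ring
  rw [gegenbauer]
  simp only [h5, h4, gegenbauerRatio, eval_mul, eval_sub, eval_C, eval_X]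
  have e1 : (n : ℝ) + 2 * 6 - 2 = n + 10 := by ring
  have e2 : (n : ℝ) + 2 * 4 - 2 = n + 6 := by ring
  push_cast
  rw [e1, e2]
  field_simp
  ring

/-- The leading coefficient of `Q_{n,6}`. -/
noncomputable def leadSix (n : ℕ) : ℝ :=
  (n : ℝ) * (n + 2) * (n + 4) * (n + 6) * (n + 8) * (n + 10) / 720

/-- The extremal coefficient of `Q_{n,2}`. -/
noncomputable def coeffTwo (n : ℕ) : ℝ := ((n : ℝ) - 2) * (n + 4) * (n + 10) / (32 * (n + 8))

/-- The negative of the minimum of the extremal combination. -/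
noncomputable def negMin (n : ℕ) : ℝ :=
  ((n : ℝ) + 2) * (n + 6) * (n + 10) * (7 * n - 4) / (192 * (n + 8))

/-- The square of the positive zero of the extremal polynomial. -/
noncomputable def zeroSq (n : ℕ) : ℝ := 15 / (2 * ((n : ℝ) + 8))

theorem leadSix_pos {n : ℕ} (hn : 2 ≤ n) : 0 < leadSix n := by
  have h : (2 : ℝ) ≤ n := by exact_mod_cast hn
  unfold leadSix
  positivity

theorem negMin_pos {n : ℕ} (hn : 2 ≤ n) : 0 < negMin n := by
  have h : (2 : ℝ) ≤ n := by exact_mod_cast hn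
  have : 0 < 7 * (n : ℝ) - 4 := by linarith
  unfold negMin
  positivity

theorem zeroSq_pos (n : ℕ) : 0 < zeroSq n := by
  unfold zeroSq
  positivity

theorem zeroSq_lt_one {n : ℕ} : zeroSq n < 1 := by
  unfold zeroSq
  rw [div_lt_one (by positivity)]
  have : (0 : ℝ) ≤ n := by positivity
  linarith

/-- The `x⁴` coefficient comes from `Q_{n,6}` alone and forces `zeroSq n`; `coeffTwo n` then
corrects the `x²` coefficient, and `negMin n` absorbs the constant. -/
theorem testPolynomial_eval {n : ℕ} (hn : 2 ≤ n) {f : ℕ → ℝ} (hf : f 6 = 1) (x : ℝ) :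
    (testPolynomial n {6, 2} f).eval x = leadSix n * (x ^ 2 * (x ^ 2 - zeroSq n) ^ 2)
      + (f 2 - coeffTwo n) * ((n + 2) / 2 * (n * x ^ 2 - 1)) - negMin n := by
  rw [testPolynomial, Finset.sum_pair (by norm_num), hf, eval_add, eval_mul, eval_mul,
    gegenbauer_two_eval hn, gegenbauer_six_eval hn, eval_C, eval_C]
  unfold leadSix zeroSq coeffTwo negMin
  field_simp
  ring

theorem sup_six_two : (({6, 2} : Finset ℕ).sup id) = 6 := rfl

/-- A cubic `A s (s - a)² + δ s` with `δ < 0` has at most one minimiser over `[0, 1]`. -/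
theorem cubic_min_unique {A a δ s t : ℝ} (hA : 0 < A) (ha : 0 < a) (ha1 : a < 1) (hδ : δ < 0)
    (hs0 : 0 ≤ s) (hst : s < t) (ht1 : t ≤ 1)
    (hs : ∀ u, 0 ≤ u → u ≤ 1 →
      A * (s * (s - a) ^ 2) + δ * s ≤ A * (u * (u - a) ^ 2) + δ * u)
    (ht : ∀ u, 0 ≤ u → u ≤ 1 →
      A * (t * (t - a) ^ 2) + δ * t ≤ A * (u * (u - a) ^ 2) + δ * u) : False := by
  -- The value at `0` is `0`, which exceeds the value `δ a < 0` at `a`.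
  have hspos : 0 < s := by
    rcases hs0.eq_or_lt with h | h
    · have := hs a ha.le ha1.le
      subst h
      nlinarith [mul_neg_of_neg_of_pos hδ ha]
    · exact h
  have heq := le_antisymm (hs t (by linarith) ht1) (ht s hs0 (by linarith))
  -- Subtracting the common value at `s` and `t` leaves a cubic with roots `s`, `t` and `q`, the
  -- root sum being `2a`. Its value at `0` forces `q ≤ 0`, so it is negative between `s` and `t`.
  set q := 2 * a - s - t with hq
  have hfac : ∀ u, A * (u * (u - a) ^ 2) + δ * u - (A * (s * (s - a) ^ 2) + δ * s) =
      A * ((u - s) * (u - t) * (u - q)) := by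
    intro u
    have h1 : δ = -A * (t ^ 2 + t * s + s ^ 2 - 2 * a * (t + s) + a ^ 2) := by
      have h2 : (t - s) * (A * (t ^ 2 + t * s + s ^ 2 - 2 * a * (t + s) + a ^ 2) + δ) = 0 := by
        linear_combination -heq
      rcases mul_eq_zero.1 h2 with h | h
      · linarith
      · linarith
    rw [h1, hq]
    ring
  have h0 := hs 0 le_rfl zero_le_one
  have h0' := hfac 0
  have hm := hs ((s + t) / 2) (by linarith) (by linarith)
  have hm' := hfac ((s + t) / 2)
  have e0 : 0 ≤ (0 - s) * (0 - t) * (0 - q) := by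
    by_contra hc
    nlinarith [mul_neg_of_pos_of_neg hA (not_le.1 hc)]
  have hq0 : q ≤ 0 := by
    by_contra hc
    nlinarith [mul_pos (mul_pos hspos (hspos.trans hst)) (not_le.1 hc)]
  have em : 0 ≤ ((s + t) / 2 - s) * ((s + t) / 2 - t) * ((s + t) / 2 - q) := by
    by_contra hc
    nlinarith [mul_neg_of_pos_of_neg hA (not_le.1 hc)]
  nlinarith [mul_pos (mul_pos (sub_pos.2 hst) (sub_pos.2 hst))
    (show 0 < (s + t) / 2 - q by linarith)]

theorem IsFisherFamily.apply_six {n : ℕ} {f : ℕ → ℝ} (hf : IsFisherFamily n {6, 2} f) :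
    f 6 = 1 := hf.2.2.1

theorem IsFisherFamily.apply_two {n : ℕ} (hn : 2 ≤ n) {f : ℕ → ℝ}
    (hf : IsFisherFamily n {6, 2} f) : f 2 = coeffTwo n := by
  have hN : (2 : ℝ) ≤ n := by exact_mod_cast hn
  have hcard := hf.2.2.2.2
  have heval := testPolynomial_eval hn hf.apply_six
  have hA := leadSix_pos hn
  rw [show ({6, 2} : Finset ℕ).card = 2 from rfl, Set.ncard_eq_two] at hcard
  obtain ⟨x, y, hxy, hset⟩ := hcard
  have hx : x ∈ ({x, y} : Set ℝ) := by simp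
  have hy : y ∈ ({x, y} : Set ℝ) := by simp
  rw [← hset] at hx hy
  clear hset
  wlog hlt : x < y generalizing x y
  · exact this y x hxy.symm hy hx (lt_of_le_of_ne (not_lt.1 hlt) hxy.symm)
  obtain ⟨hx0, hx1, hx⟩ := hx
  obtain ⟨hy0, hy1, hy⟩ := hy
  rw [isMinOn_iff] at hx hy
  simp only [heval] at hx hy
  set δ := (f 2 - coeffTwo n) * ((n + 2) / 2 * n) with hδ
  have key : ∀ z : ℝ, (∀ w ∈ Set.Icc (-1 : ℝ) 1,
      leadSix n * (z ^ 2 * (z ^ 2 - zeroSq n) ^ 2)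
        + (f 2 - coeffTwo n) * ((n + 2) / 2 * (n * z ^ 2 - 1)) - negMin n ≤
      leadSix n * (w ^ 2 * (w ^ 2 - zeroSq n) ^ 2)
        + (f 2 - coeffTwo n) * ((n + 2) / 2 * (n * w ^ 2 - 1)) - negMin n) →
      ∀ u, 0 ≤ u → u ≤ 1 → leadSix n * (z ^ 2 * (z ^ 2 - zeroSq n) ^ 2) + δ * z ^ 2 ≤
        leadSix n * (u * (u - zeroSq n) ^ 2) + δ * u := by
    intro z hz u hu0 hu1
    have := hz (√u) ⟨by linarith [Real.sqrt_nonneg u], Real.sqrt_le_one.2 hu1⟩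
    rw [Real.sq_sqrt hu0] at this
    rw [hδ]
    linarith
  -- For `δ < 0` the minimiser in `u = x²` is unique; for `δ > 0` it is only `u = 0`, although `y >
  -- 0`. Two minimisers leave `δ = 0`.
  rcases lt_trichotomy δ 0 with h | h | h
  · exact (cubic_min_unique hA (zeroSq_pos n) zeroSq_lt_one h (sq_nonneg x)
      (by nlinarith) (by nlinarith) (key x hx) (key y hy)).elim
  · have : ((n : ℝ) + 2) / 2 * n ≠ 0 := by positivity
    have := (mul_eq_zero.1 h).resolve_right this
    linarith
  · have := key y hy 0 le_rfl zero_le_one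
    have hypos : 0 < y ^ 2 := by nlinarith
    have : 0 ≤ leadSix n * (y ^ 2 * (y ^ 2 - zeroSq n) ^ 2) := by positivity
    nlinarith [mul_pos h hypos]

theorem extremal_eval {n : ℕ} (hn : 2 ≤ n) {f : ℕ → ℝ} (h6 : f 6 = 1) (h2 : f 2 = coeffTwo n)
    (x : ℝ) : (testPolynomial n {6, 2} f).eval x =
      leadSix n * (x ^ 2 * (x ^ 2 - zeroSq n) ^ 2) - negMin n := by
  rw [testPolynomial_eval hn h6, h2]
  ring

theorem extremal_factor_eq_zero_iff {n : ℕ} (hn : 2 ≤ n) (x : ℝ) :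
    leadSix n * (x ^ 2 * (x ^ 2 - zeroSq n) ^ 2) = 0 ↔
      x ∈ ({0, √(zeroSq n), -√(zeroSq n)} : Set ℝ) := by
  have hA := (leadSix_pos hn).ne'
  have : x ^ 2 - zeroSq n = (x - √(zeroSq n)) * (x + √(zeroSq n)) := by
    have := Real.sq_sqrt (zeroSq_pos n).le
    linear_combination this
  simp [hA, this, sub_eq_zero, eq_neg_iff_add_eq_zero]

theorem sqrt_zeroSq_mem (n : ℕ) : 0 < √(zeroSq n) ∧ √(zeroSq n) ≤ 1 :=
  ⟨Real.sqrt_pos.2 (zeroSq_pos n), Real.sqrt_le_one.2 zeroSq_lt_one.le⟩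

theorem extremal_isMinOn_iff {n : ℕ} (hn : 2 ≤ n) {f : ℕ → ℝ} (h6 : f 6 = 1)
    (h2 : f 2 = coeffTwo n) (x : ℝ) :
    IsMinOn (fun u : ℝ => (testPolynomial n {6, 2} f).eval u) (Set.Icc (-1) 1) x ↔
      x ∈ ({0, √(zeroSq n), -√(zeroSq n)} : Set ℝ) := by
  have hA := leadSix_pos hn
  rw [← extremal_factor_eq_zero_iff hn, isMinOn_iff]
  simp only [extremal_eval hn h6 h2]
  constructor
  · intro h
    have := h 0 ⟨by norm_num, by norm_num⟩
    refine le_antisymm (by linarith) (by positivity)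
  · intro h w _
    rw [h]
    have : 0 ≤ leadSix n * (w ^ 2 * (w ^ 2 - zeroSq n) ^ 2) := by positivity
    linarith

theorem extremal_isNegMin {n : ℕ} (hn : 2 ≤ n) {f : ℕ → ℝ} (h6 : f 6 = 1)
    (h2 : f 2 = coeffTwo n) : IsNegMin n {6, 2} f (negMin n) := by
  have hA := leadSix_pos hn
  refine ⟨⟨0, ⟨by norm_num, by norm_num⟩, by simp [extremal_eval hn h6 h2]⟩, ?_⟩
  rintro _ ⟨w, -, rfl⟩
  simp only [extremal_eval hn h6 h2]
  have : 0 ≤ leadSix n * (w ^ 2 * (w ^ 2 - zeroSq n) ^ 2) := by positivity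
  linarith

/-- The coefficients of the extremal combination. -/
noncomputable def extremalFamily (n t : ℕ) : ℝ :=
  if t = 6 then 1 else if t = 2 then coeffTwo n else 0

theorem isFisherFamily_extremalFamily {n : ℕ} (hn : 2 ≤ n) :
    IsFisherFamily n {6, 2} (extremalFamily n) := by
  refine ⟨by simp, by rw [sup_six_two]; decide, rfl, ?_, ?_⟩
  · intro t ht
    simp only [Finset.mem_insert, Finset.mem_singleton, not_or] at ht
    simp [extremalFamily, ht]
  · simp only [extremal_isMinOn_iff hn (f := extremalFamily n) rfl rfl]
    obtain ⟨h0, h1⟩ := sqrt_zeroSq_mem n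
    rw [show ({6, 2} : Finset ℕ).card = 2 from rfl, Set.ncard_eq_two]
    refine ⟨0, √(zeroSq n), h0.ne, ?_⟩
    ext x
    simp only [Set.mem_ofPred_eq, Set.mem_insert_iff, Set.mem_singleton_iff]
    constructor
    · rintro ⟨hx, -, h | h | h⟩
      · exact Or.inl h
      · exact Or.inr h
      · linarith
    · rintro (rfl | rfl)
      · simp
      · exact ⟨h0.le, h1, by simp⟩

theorem IsFisherFamily.eq_extremalFamily {n : ℕ} (hn : 2 ≤ n) {f : ℕ → ℝ}
    (hf : IsFisherFamily n {6, 2} f) : f = extremalFamily n := by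
  funext t
  unfold extremalFamily
  split_ifs with h6 h2
  · rw [h6, hf.apply_six]
  · rw [h2, hf.apply_two hn]
  · exact hf.2.2.2.1 t (by simp [h6, h2])

/-- The Fisher type bound for the index set `{6, 2}`. -/
noncomputable def fisherBound (n : ℕ) : ℝ :=
  (n : ℝ) * (n + 4) * (2 * n + 1) ^ 2 / (15 * (7 * n - 4))

theorem fisherBound_mul_negMin {n : ℕ} (hn : 2 ≤ n) :
    fisherBound n * negMin n = leadSix n * (1 - zeroSq n) ^ 2 := by
  have h : (2 : ℝ) ≤ n := by exact_mod_cast hn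
  have : 7 * (n : ℝ) - 4 ≠ 0 := by linarith
  unfold fisherBound negMin leadSix zeroSq
  generalize 7 * (n : ℝ) - 4 = d at this ⊢
  field_simp
  ring

theorem isFisherBound_iff {n : ℕ} (hn : 2 ≤ n) (b : ℝ) :
    IsFisherBound n {6, 2} b ↔ b = fisherBound n := by
  have hc := negMin_pos hn
  have hval : ∀ f : ℕ → ℝ, f 6 = 1 → f 2 = coeffTwo n →
      (negMin n + (testPolynomial n {6, 2} f).eval 1) / negMin n = fisherBound n := by
    intro f h6 h2
    rw [extremal_eval hn h6 h2, div_eq_iff hc.ne', fisherBound_mul_negMin hn]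
    ring
  constructor
  · rintro ⟨f, hf, -, c, -, hmin, rfl⟩
    have h := hmin.unique (extremal_isNegMin hn hf.apply_six (hf.apply_two hn))
    rw [neg_inj.1 h, hval f hf.apply_six (hf.apply_two hn)]
  · rintro rfl
    exact ⟨extremalFamily n, isFisherFamily_extremalFamily hn,
      fun g hg => hg.eq_extremalFamily hn, negMin n, hc, extremal_isNegMin hn rfl rfl,
      (hval _ rfl rfl).symm⟩

end HarmonicIndex

/-! ### Zonal harmonics and the Fisher type inequality. -/

namespace HarmonicIndex

open MvPolynomial

/-- The linear form `x ↦ ⟨y, x⟩`. -/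
noncomputable def linForm {n : ℕ} (y : EuclideanSpace ℝ (Fin n)) : MvPolynomial (Fin n) ℝ :=
  ∑ i, C (y i) * X i

/-- The quadratic form `x ↦ ‖x‖²`. -/
noncomputable def normForm (n : ℕ) : MvPolynomial (Fin n) ℝ := ∑ i, X i ^ 2

theorem pderiv_linForm {n : ℕ} (y : EuclideanSpace ℝ (Fin n)) (i : Fin n) :
    pderiv i (linForm y) = C (y i) := by
  classical
  simp [linForm, pderiv_X, Pi.single_apply]

theorem pderiv_normForm {n : ℕ} (i : Fin n) :
    pderiv i (normForm n) = 2 * X i := by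
  classical
  simp [normForm, pderiv_X, Pi.single_apply]

theorem isHomogeneous_linForm {n : ℕ} (y : EuclideanSpace ℝ (Fin n)) :
    (linForm y).IsHomogeneous 1 :=
  IsHomogeneous.sum _ _ _ fun i _ => by
    simpa using (isHomogeneous_C (Fin n) (y i)).mul (isHomogeneous_X ℝ i)

theorem isHomogeneous_normForm (n : ℕ) : (normForm n).IsHomogeneous 2 :=
  IsHomogeneous.sum _ _ _ fun i _ => by simpa using (isHomogeneous_X ℝ i).pow 2

theorem eval_linForm {n : ℕ} (x y : EuclideanSpace ℝ (Fin n)) :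
    eval (fun i => x i) (linForm y) = inner ℝ x y := by
  simp [linForm, PiLp.inner_apply]

theorem eval_normForm {n : ℕ} (x : EuclideanSpace ℝ (Fin n)) :
    eval (fun i => x i) (normForm n) = ‖x‖ ^ 2 := by
  simp [normForm, EuclideanSpace.norm_sq_eq]

/-- The sum over the coordinates of a combination of the terms that occur in the Laplacian of a
polynomial in `linForm y` and `normForm n`. -/
theorem sum_laplacian_terms {n : ℕ} {y : EuclideanSpace ℝ (Fin n)} (hy : ‖y‖ = 1)
    (p q r s : MvPolynomial (Fin n) ℝ) :
    ∑ i, (p * C (y i) ^ 2 + q * (C (y i) * X i) + r * X i ^ 2 + s) =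
      p + q * linForm y + r * normForm n + n * s := by
  have h : ∑ i, (C (y i) ^ 2 : MvPolynomial (Fin n) ℝ) = 1 := by
    have h := EuclideanSpace.norm_sq_eq y
    simp only [hy, Real.norm_eq_abs, sq_abs] at h
    simp only [← C_pow, ← map_sum]
    rw [← h]
    simp
  simp only [Finset.sum_add_distrib, ← Finset.mul_sum, h]
  simp [linForm, normForm]

/-- This is `Q_{n,2}(⟨x, y⟩)`, up to a constant factor, made homogeneous by powers of `‖x‖²`; the
degree 6 form below arises in the same way. -/
theorem isHarmonicForm_zonal_two {n : ℕ} {y : EuclideanSpace ℝ (Fin n)} (hy : ‖y‖ = 1) :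
    IsHarmonicForm n 2 (C (n : ℝ) * linForm y ^ 2 - normForm n) := by
  have hl := isHomogeneous_linForm y
  refine ⟨?_, ?_⟩
  · simpa using ((isHomogeneous_C (Fin n) (n : ℝ)).mul (hl.pow 2)).sub (isHomogeneous_normForm n)
  · have h : ∀ i, pderiv i (pderiv i (C (n : ℝ) * linForm y ^ 2 - normForm n)) =
        (C (n : ℝ) * 2) * C (y i) ^ 2 + 0 * (C (y i) * X i) + 0 * X i ^ 2 + (-2) := by
      intro i
      have h2 : pderiv i (2 : MvPolynomial (Fin n) ℝ) = 0 := pderiv_C (a := (2 : ℝ))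
      simp [pderiv_linForm, pderiv_normForm, h2]
      ring
    rw [Finset.sum_congr rfl fun i _ => h i, sum_laplacian_terms hy]
    simp

theorem isHarmonicForm_zonal_six {n : ℕ} {y : EuclideanSpace ℝ (Fin n)} (hy : ‖y‖ = 1) :
    IsHarmonicForm n 6 (C (((n : ℝ) + 4) * (n + 6) * (n + 8)) * linForm y ^ 6
      - C (15 * ((n : ℝ) + 4) * (n + 6)) * (linForm y ^ 4 * normForm n)
      + C (45 * ((n : ℝ) + 4)) * (linForm y ^ 2 * normForm n ^ 2) - C 15 * normForm n ^ 3) := by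
  have hl := isHomogeneous_linForm y
  have hr := isHomogeneous_normForm n
  have hC := fun a : ℝ => isHomogeneous_C (Fin n) a
  set a := ((n : ℝ) + 4) * (n + 6) * (n + 8) with ha
  set b := 15 * ((n : ℝ) + 4) * (n + 6) with hb
  set c := 45 * ((n : ℝ) + 4) with hc
  refine ⟨?_, ?_⟩
  · refine ((IsHomogeneous.sub ?_ ?_).add ?_).sub ?_
    · simpa using (hC a).mul (hl.pow 6)
    · simpa using (hC b).mul ((hl.pow 4).mul hr)
    · simpa using (hC c).mul ((hl.pow 2).mul (hr.pow 2))
    · simpa using (hC 15).mul (hr.pow 3)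
  · have h : ∀ i, pderiv i (pderiv i (C a * linForm y ^ 6 - C b * (linForm y ^ 4 * normForm n)
        + C c * (linForm y ^ 2 * normForm n ^ 2) - C 15 * normForm n ^ 3)) =
        (C a * 30 * linForm y ^ 4 - C b * 12 * linForm y ^ 2 * normForm n
          + C c * 2 * normForm n ^ 2) * C (y i) ^ 2
        + (-C b * 16 * linForm y ^ 3 + C c * 16 * linForm y * normForm n) * (C (y i) * X i)
        + (C c * 8 * linForm y ^ 2 - C 15 * 24 * normForm n) * X i ^ 2
        + (-C b * 2 * linForm y ^ 4 + C c * 4 * linForm y ^ 2 * normForm n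
          - C 15 * 6 * normForm n ^ 2) := by
      intro i
      have h2 : pderiv i (2 : MvPolynomial (Fin n) ℝ) = 0 := pderiv_C (a := (2 : ℝ))
      have h3 : pderiv i (3 : MvPolynomial (Fin n) ℝ) = 0 := pderiv_C (a := (3 : ℝ))
      have h4 : pderiv i (4 : MvPolynomial (Fin n) ℝ) = 0 := pderiv_C (a := (4 : ℝ))
      have h6 : pderiv i (6 : MvPolynomial (Fin n) ℝ) = 0 := pderiv_C (a := (6 : ℝ))
      simp only [map_add, map_sub, pderiv_mul, pderiv_pow, pderiv_linForm, pderiv_normForm,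
        pderiv_C, pderiv_X_self, h2, h3, h4, h6, Nat.cast_ofNat]
      norm_num
      ring
    rw [Finset.sum_congr rfl fun i _ => h i, sum_laplacian_terms hy, ha, hb, hc]
    simp only [map_mul, map_add, map_natCast, map_ofNat]
    ring

theorem IsDesign.sum_gegenbauer_two {n : ℕ} (hn : 2 ≤ n) {Y : Finset (EuclideanSpace ℝ (Fin n))}
    (hY : IsDesign n {6, 2} Y) {y : EuclideanSpace ℝ (Fin n)} (hy : ‖y‖ = 1) :
    ∑ x ∈ Y, (gegenbauer n 2).eval (inner ℝ x y) = 0 := by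
  have h := hY.2.2 2 (by simp) _ (isHarmonicForm_zonal_two hy)
  have h' : ∑ x ∈ Y, ((n : ℝ) * inner ℝ x y ^ 2 - 1) = 0 := by
    rw [← h]
    refine Finset.sum_congr rfl fun x hx => ?_
    simp [eval_linForm, eval_normForm, hY.2.1 x hx]
  simp only [gegenbauer_two_eval hn, ← Finset.mul_sum, h', mul_zero]

theorem IsDesign.sum_gegenbauer_six {n : ℕ} (hn : 2 ≤ n) {Y : Finset (EuclideanSpace ℝ (Fin n))}
    (hY : IsDesign n {6, 2} Y) {y : EuclideanSpace ℝ (Fin n)} (hy : ‖y‖ = 1) :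
    ∑ x ∈ Y, (gegenbauer n 6).eval (inner ℝ x y) = 0 := by
  have h := hY.2.2 6 (by simp) _ (isHarmonicForm_zonal_six hy)
  have h' : ∑ x ∈ Y, (((n : ℝ) + 4) * (n + 6) * (n + 8) * inner ℝ x y ^ 6
      - 15 * (n + 4) * (n + 6) * inner ℝ x y ^ 4 + 45 * (n + 4) * inner ℝ x y ^ 2 - 15) = 0 := by
    rw [← h]
    refine Finset.sum_congr rfl fun x hx => ?_
    simp [eval_linForm, eval_normForm, hY.2.1 x hx]
  simp only [gegenbauer_six_eval hn, ← Finset.mul_sum, h', mul_zero]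

/-- In `F = Q_{n,6} + f₂ Q_{n,2} + c` only the constant survives summation over a design. -/
theorem IsDesign.sum_sum_extremal {n : ℕ} (hn : 2 ≤ n) {Y : Finset (EuclideanSpace ℝ (Fin n))}
    (hY : IsDesign n {6, 2} Y) :
    ∑ y ∈ Y, ∑ x ∈ Y, leadSix n * ((inner ℝ x y) ^ 2 * ((inner ℝ x y) ^ 2 - zeroSq n) ^ 2) =
      (Y.card : ℝ) * (Y.card * negMin n) := by
  have h : ∀ y ∈ Y, ∑ x ∈ Y,
      leadSix n * ((inner ℝ x y) ^ 2 * ((inner ℝ x y) ^ 2 - zeroSq n) ^ 2) =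
        Y.card * negMin n := by
    intro y hy
    have e : ∀ u : ℝ, leadSix n * (u ^ 2 * (u ^ 2 - zeroSq n) ^ 2) =
        (gegenbauer n 6).eval u + coeffTwo n * (gegenbauer n 2).eval u + negMin n := by
      intro u
      have h1 := extremal_eval hn (f := extremalFamily n) rfl rfl u
      rw [testPolynomial, Finset.sum_pair (by norm_num)] at h1
      simp [extremalFamily] at h1
      linarith
    simp only [e, Finset.sum_add_distrib, ← Finset.mul_sum, hY.sum_gegenbauer_two hn (hY.2.1 y hy),
      hY.sum_gegenbauer_six hn (hY.2.1 y hy)]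
    simp
  rw [Finset.sum_congr rfl h]
  simp

/-- Each diagonal term of the double sum is `F(1) = b c`; moving these to the left leaves the
off-diagonal part. -/
theorem IsDesign.card_mul_sub {n : ℕ} (hn : 2 ≤ n) {Y : Finset (EuclideanSpace ℝ (Fin n))}
    (hY : IsDesign n {6, 2} Y) :
    ((Y.card : ℝ) - fisherBound n) * (Y.card * negMin n) =
      ∑ y ∈ Y, ∑ x ∈ Y with x ≠ y,
        leadSix n * ((inner ℝ x y) ^ 2 * ((inner ℝ x y) ^ 2 - zeroSq n) ^ 2) := by
  classical
  have h : ∀ y ∈ Y, ∑ x ∈ Y,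
      leadSix n * ((inner ℝ x y) ^ 2 * ((inner ℝ x y) ^ 2 - zeroSq n) ^ 2) =
      fisherBound n * negMin n + ∑ x ∈ Y with x ≠ y,
        leadSix n * ((inner ℝ x y) ^ 2 * ((inner ℝ x y) ^ 2 - zeroSq n) ^ 2) := by
    intro y hy
    rw [Finset.filter_ne', ← Finset.add_sum_erase _ _ hy, real_inner_self_eq_norm_sq, hY.2.1 y hy,
      fisherBound_mul_negMin hn]
    ring
  have h2 := hY.sum_sum_extremal hn
  rw [Finset.sum_congr rfl h, Finset.sum_add_distrib, Finset.sum_const, nsmul_eq_mul] at h2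
  linarith

theorem IsDesign.fisherBound_le {n : ℕ} (hn : 2 ≤ n) {Y : Finset (EuclideanSpace ℝ (Fin n))}
    (hY : IsDesign n {6, 2} Y) : fisherBound n ≤ Y.card := by
  have hA := leadSix_pos hn
  have hc := negMin_pos hn
  have h := hY.card_mul_sub hn
  have hpos : 0 < (Y.card : ℝ) * negMin n := by
    have : 0 < (Y.card : ℝ) := by exact_mod_cast hY.1.card_pos
    positivity
  have hnn : 0 ≤ ((Y.card : ℝ) - fisherBound n) * (Y.card * negMin n) := by
    rw [h]
    exact Finset.sum_nonneg fun y _ => Finset.sum_nonneg fun x _ => by positivity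
  exact sub_nonneg.1 (nonneg_of_mul_nonneg_left hnn hpos)

theorem IsDesign.card_eq_iff {n : ℕ} (hn : 2 ≤ n) {Y : Finset (EuclideanSpace ℝ (Fin n))}
    (hY : IsDesign n {6, 2} Y) : (Y.card : ℝ) = fisherBound n ↔
      innerProducts Y ⊆ {0, √(zeroSq n), -√(zeroSq n)} := by
  have hA := leadSix_pos hn
  have hpos : (Y.card : ℝ) * negMin n ≠ 0 :=
    mul_ne_zero (by exact_mod_cast hY.1.card_pos.ne') (negMin_pos hn).ne'
  rw [← sub_eq_zero, ← mul_eq_zero_iff_right hpos, hY.card_mul_sub hn,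
    Finset.sum_eq_zero_iff_of_nonneg
      fun y _ => Finset.sum_nonneg fun x _ => by positivity]
  constructor
  · rintro h _ ⟨x, hx, y, hy, hxy, rfl⟩
    have := (Finset.sum_eq_zero_iff_of_nonneg fun x _ => by positivity).1 (h y hy) x
      (Finset.mem_filter.2 ⟨hx, hxy⟩)
    exact (extremal_factor_eq_zero_iff hn _).1 this
  · intro h y hy
    refine Finset.sum_eq_zero fun x hx => ?_
    rw [Finset.mem_filter] at hx
    exact (extremal_factor_eq_zero_iff hn _).2 (h ⟨x, hx.1, y, hy, hx.2, rfl⟩)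

theorem coe_pair_six_two : (({6, 2} : Finset ℕ) : Set ℕ) = {6, 2} := by simp

theorem isTightDesign_iff {n : ℕ} (hn : 2 ≤ n) {Y : Finset (EuclideanSpace ℝ (Fin n))} :
    IsTightDesign n {6, 2} Y ↔ IsDesign n {6, 2} Y ∧ (Y.card : ℝ) = fisherBound n := by
  rw [IsTightDesign, isFisherBound_iff hn, coe_pair_six_two]

end HarmonicIndex

/-! ### Integrality of eigenvalues of large multiplicity. -/

namespace HarmonicIndex

open Polynomial

/-- Write `q = p ^ m * r` with `p` the minimal polynomial and `p ∤ r`. In characteristic zero `p` is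
separable, so `x` is a simple root of `p`; it is not a root of `r`, hence its multiplicity in `q` is
exactly `m`. -/
theorem minpoly_pow_rootMultiplicity_dvd {K L : Type*} [Field K] [CharZero K] [Field L]
    [Algebra K L] {x : L} (hx : IsIntegral K x) {q : K[X]} (hq : q ≠ 0) :
    minpoly K x ^ (q.map (algebraMap K L)).rootMultiplicity x ∣ q := by
  classical
  have hirr := minpoly.irreducible hx
  have hfin : FiniteMultiplicity (minpoly K x) q :=
    FiniteMultiplicity.of_not_isUnit hirr.not_isUnit hq
  obtain ⟨r, hr, hndvd⟩ := hfin.exists_eq_pow_mul_and_not_dvd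
  have hsep : (minpoly K x).Separable := hirr.separable
  have hp1 : ((minpoly K x).map (algebraMap K L)).rootMultiplicity x = 1 := by
    refine le_antisymm (rootMultiplicity_le_one_of_separable hsep.map x) ?_
    rw [Nat.succ_le_iff, rootMultiplicity_pos ((Polynomial.map_ne_zero_iff
      (algebraMap K L).injective).2 hirr.ne_zero), IsRoot.def, eval_map_algebraMap, minpoly.aeval]
  have hr0 : (r.map (algebraMap K L)).rootMultiplicity x = 0 := by
    refine rootMultiplicity_eq_zero fun h => hndvd (minpoly.dvd K x ?_)
    rwa [IsRoot.def, eval_map_algebraMap] at h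
  have hne : q.map (algebraMap K L) ≠ 0 :=
    (Polynomial.map_ne_zero_iff (algebraMap K L).injective).2 hq
  have : (q.map (algebraMap K L)).rootMultiplicity x = multiplicity (minpoly K x) q := by
    conv_lhs => rw [hr]
    rw [hr, Polynomial.map_mul, Polynomial.map_pow] at hne
    rw [Polynomial.map_mul, Polynomial.map_pow, rootMultiplicity_mul hne, hr0, add_zero,
      ← count_roots, roots_pow, Multiset.count_nsmul, count_roots, hp1, mul_one]
  rw [this]
  exact pow_multiplicity_dvd _ _

/-- An eigenvalue of an integer matrix whose eigenspace has more than half the full dimension is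
an integer. -/
theorem exists_int_of_two_mul_finrank_eigenspace_gt {ι : Type*} [Fintype ι] [DecidableEq ι]
    (A : Matrix ι ι ℤ) (μ : ℝ)
    (h : Fintype.card ι <
      2 * Module.finrank ℝ (Module.End.eigenspace (Matrix.toLin' (A.map (Int.cast : ℤ → ℝ))) μ)) :
    ∃ m : ℤ, μ = m := by
  set φ := Matrix.toLin' (A.map (Int.cast : ℤ → ℝ)) with hφ
  have hle := LinearMap.finrank_eigenspace_le φ μ
  have hchar : φ.charpoly = A.charpoly.map (Int.castRingHom ℝ) := by
    rw [hφ, Matrix.charpoly_toLin', ← Matrix.charpoly_map]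
    rfl
  have hmonic : A.charpoly.Monic := A.charpoly_monic
  have hpos : 0 < φ.charpoly.rootMultiplicity μ := by omega
  have hroot : φ.charpoly.IsRoot μ := (rootMultiplicity_pos'.1 hpos).2
  have hintZ : IsIntegral ℤ μ :=
    ⟨A.charpoly, hmonic, by rw [hchar, IsRoot.def, eval_map] at hroot; exact hroot⟩
  have hintQ : IsIntegral ℚ μ := hintZ.tower_top
  set q : ℚ[X] := A.charpoly.map (Int.castRingHom ℚ) with hq
  have hqm : q.Monic := hmonic.map _
  have hqmap : q.map (algebraMap ℚ ℝ) = φ.charpoly := by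
    rw [hq, Polynomial.map_map, hchar]
    congr 1
  have hdvd := minpoly_pow_rootMultiplicity_dvd hintQ hqm.ne_zero
  -- Degree of the minimal polynomial times multiplicity is at most the dimension, which is less
  -- than twice the multiplicity. So the degree is 1, and a rational algebraic integer is an
  -- integer.
  have hdeg := natDegree_le_of_dvd hdvd hqm.ne_zero
  rw [hqmap, natDegree_pow, hq, hmonic.natDegree_map, A.charpoly_natDegree_eq_dim] at hdeg
  have hd1 : (minpoly ℚ μ).natDegree = 1 := by
    have := minpoly.natDegree_pos hintQ
    by_contra hne
    have h2 : 2 ≤ (minpoly ℚ μ).natDegree := by omega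
    have := Nat.mul_le_mul_left (φ.charpoly.rootMultiplicity μ) h2
    omega
  obtain ⟨r, hr⟩ := minpoly.mem_range_of_degree_eq_one ℚ μ
    ((degree_eq_iff_natDegree_eq (minpoly.ne_zero hintQ)).2 hd1)
  have hintr : IsIntegral ℤ r := by
    rw [← hr] at hintZ
    exact (isIntegral_algebraMap_iff (algebraMap ℚ ℝ).injective).1 hintZ
  obtain ⟨m, hm⟩ := IsIntegrallyClosed.isIntegral_iff.1 hintr
  refine ⟨m, ?_⟩
  rw [← hr, ← hm]
  simp

/-- The Gram matrix is `1 + α A` with `A` an integer matrix. Linear relations among the points lie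
in its kernel, the eigenspace of `A` for `-1/α`; they form a space of dimension at least `|Y| - n >
|Y| / 2`. -/
theorem exists_int_one_div_of_two_mul_lt_card {n : ℕ} {α : ℝ}
    {Y : Finset (EuclideanSpace ℝ (Fin n))} (hα : α ≠ 0) (hY : ∀ x ∈ Y, ‖x‖ = 1)
    (hI : innerProducts Y ⊆ {0, α, -α}) (hcard : 2 * n < Y.card) : ∃ m : ℤ, 1 / α = m := by
  classical
  have hA : ∀ x y : Y, ∃ a : ℤ, inner ℝ (x : EuclideanSpace ℝ (Fin n)) y =
      (if x = y then 1 else 0) + α * a := by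
    intro x y
    by_cases hxy : x = y
    · refine ⟨0, ?_⟩
      subst hxy
      simp [hY x x.2]
    · rcases hI ⟨x, x.2, y, y.2, fun h => hxy (Subtype.ext h), rfl⟩ with h | h | h
      · exact ⟨0, by simp [hxy, h]⟩
      · exact ⟨1, by simp [hxy, h]⟩
      · exact ⟨-1, by simpa [hxy] using h⟩
  choose a ha using hA
  let T : (Y → ℝ) →ₗ[ℝ] EuclideanSpace ℝ (Fin n) :=
    Fintype.linearCombination ℝ fun y : Y => (y : EuclideanSpace ℝ (Fin n))
  have hsub : LinearMap.ker T ≤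
      Module.End.eigenspace (Matrix.toLin' ((Matrix.of a).map (Int.cast : ℤ → ℝ))) (-(1 / α)) := by
    intro c hc
    rw [Module.End.mem_eigenspace_iff]
    funext x
    have h0 : inner ℝ (x : EuclideanSpace ℝ (Fin n)) (T c) = 0 := by
      rw [LinearMap.mem_ker.1 hc, inner_zero_right]
    rw [Fintype.linearCombination_apply, inner_sum] at h0
    simp only [inner_smul_right, ha, mul_add, Finset.sum_add_distrib] at h0
    simp only [mul_ite, mul_one, mul_zero, Finset.sum_ite_eq, Finset.mem_univ, if_true] at h0
    have h1 : α * ∑ y, (a x y : ℝ) * c y = -c x := by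
      rw [Finset.mul_sum]
      rw [eq_neg_iff_add_eq_zero, add_comm, ← h0]
      congr 1
      exact Finset.sum_congr rfl fun y _ => by ring
    simp only [Matrix.toLin'_apply, Matrix.mulVec, dotProduct, Matrix.map_apply, Matrix.of_apply,
      Pi.smul_apply, smul_eq_mul]
    field_simp
    linarith
  have hrank := T.finrank_range_add_finrank_ker
  have hle := Submodule.finrank_le (LinearMap.range T)
  have hle2 := Submodule.finrank_mono hsub
  rw [Module.finrank_fintype_fun_eq_card, Fintype.card_coe] at hrank
  rw [finrank_euclideanSpace_fin] at hle
  obtain ⟨m, hm⟩ := exists_int_of_two_mul_finrank_eigenspace_gt (Matrix.of a) (-(1 / α))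
    (by rw [Fintype.card_coe]; omega)
  exact ⟨-m, by push_cast; linarith⟩

end HarmonicIndex

/-! ### The tight design in the plane. -/

namespace HarmonicIndex

open MvPolynomial

theorem eval_single_of_isHomogeneous {n k : ℕ} {f : MvPolynomial (Fin n) ℝ}
    (hf : f.IsHomogeneous k) (i : Fin n) :
    eval (Pi.single i 1) f = coeff (Finsupp.single i k) f := by
  rw [eval_eq', Finset.sum_eq_single (Finsupp.single i k)]
  · rw [Finset.prod_eq_one, mul_one]
    intro j _
    by_cases h : j = i
    · subst h; simp
    · simp [Ne.symm h]
  · intro d hd hne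
    obtain ⟨j, hji, hj⟩ : ∃ j, j ≠ i ∧ d j ≠ 0 := by
      by_contra! hc
      refine hne ?_
      have hdeg := hf (mem_support_iff.1 hd)
      have hd' : d = Finsupp.single i (d i) := by
        ext j
        by_cases h : j = i
        · subst h; simp
        · simp [hc j h, Ne.symm h]
      rw [hd'] at hdeg
      simp [Finsupp.weight_single] at hdeg
      rw [hd', hdeg]
    rw [Finset.prod_eq_zero (Finset.mem_univ j), mul_zero]
    simp [hji, hj]
  · intro h
    rw [notMem_support_iff.1 h, zero_mul]

/-- Obtained by reading off the coefficient of `X₀ᵃ X₁ᵇ` in the Laplacian. -/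
theorem IsHarmonicForm.coeff_recurrence {k : ℕ} {f : MvPolynomial (Fin 2) ℝ}
    (hf : IsHarmonicForm 2 k f) (a b : ℕ) :
    coeff (Finsupp.single 0 (a + 2) + Finsupp.single 1 b) f * ((a + 1) * (a + 2))
      + coeff (Finsupp.single 0 a + Finsupp.single 1 (b + 2)) f * ((b + 1) * (b + 2)) = 0 := by
  have h := congrArg (coeff (Finsupp.single 0 a + Finsupp.single 1 b)) hf.2
  have e0 : (Finsupp.single 0 a + Finsupp.single 1 b + Finsupp.single 0 1 + Finsupp.single 0 1 :
      Fin 2 →₀ ℕ) = Finsupp.single 0 (a + 2) + Finsupp.single 1 b := by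
    ext i; fin_cases i <;> simp
  have e1 : (Finsupp.single 0 a + Finsupp.single 1 b + Finsupp.single 1 1 + Finsupp.single 1 1 :
      Fin 2 →₀ ℕ) = Finsupp.single 0 a + Finsupp.single 1 (b + 2) := by
    ext i; fin_cases i <;> simp
  rw [Fin.sum_univ_two, coeff_add, coeff_pderiv, coeff_pderiv, coeff_pderiv, coeff_pderiv, e0, e1]
    at h
  simp [-Finsupp.single_add] at h
  linear_combination h

/-- The standard basis of the plane. -/
noncomputable def planeBasis : Finset (EuclideanSpace ℝ (Fin 2)) :=
  {EuclideanSpace.single 0 1, EuclideanSpace.single 1 1}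

theorem planeBasis_ne :
    (EuclideanSpace.single 0 1 : EuclideanSpace ℝ (Fin 2)) ≠ EuclideanSpace.single 1 1 := by
  intro h
  simpa using congrArg (fun v : EuclideanSpace ℝ (Fin 2) => v 0) h

theorem coe_planeBasis : (planeBasis : Set (EuclideanSpace ℝ (Fin 2))) = {!₂[1, 0], !₂[0, 1]} := by
  have h0 : (EuclideanSpace.single 0 1 : EuclideanSpace ℝ (Fin 2)) = !₂[1, 0] := by
    ext i; fin_cases i <;> simp
  have h1 : (EuclideanSpace.single 1 1 : EuclideanSpace ℝ (Fin 2)) = !₂[0, 1] := by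
    ext i; fin_cases i <;> simp
  rw [planeBasis, Finset.coe_pair, h0, h1]

theorem isDesign_planeBasis : IsDesign 2 {6, 2} planeBasis := by
  refine ⟨by simp [planeBasis], by simp [planeBasis], ?_⟩
  intro k hk f hf
  rw [planeBasis, Finset.sum_pair planeBasis_ne]
  have hev : ∀ i : Fin 2, eval (fun j => (EuclideanSpace.single i 1 : EuclideanSpace ℝ (Fin 2)) j) f
      = coeff (Finsupp.single i k) f := by
    intro i
    rw [← eval_single_of_isHomogeneous hf.1 i]
    congr 1
  rw [hev, hev]
  -- The recurrence links the coefficients of `X₀ᵏ` and `X₁ᵏ` through `k/2` sign changes; `k/2` is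
  -- odd for `k = 6` and `k = 2`, so the two cancel.
  rcases hk with rfl | rfl
  · have h4 := hf.coeff_recurrence 4 0
    have h2 := hf.coeff_recurrence 2 2
    have h0 := hf.coeff_recurrence 0 4
    norm_num at h4 h2 h0
    linarith
  · have h0 := hf.coeff_recurrence 0 0
    norm_num at h0
    linarith

theorem isTightDesign_planeBasis : IsTightDesign 2 {6, 2} planeBasis := by
  rw [isTightDesign_iff le_rfl]
  refine ⟨isDesign_planeBasis, ?_⟩
  rw [planeBasis, Finset.card_pair planeBasis_ne]
  norm_num [fisherBound]

/-! ### Arithmetic of the bound and nonexistence. -/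

theorem dvd_of_fisherBound_eq_int {n : ℕ} (hn : 2 ≤ n) {m : ℤ} (h : fisherBound n = m) :
    (7 * (n : ℤ) - 4) ∣ 28800 := by
  have hN : (2 : ℝ) ≤ n := by exact_mod_cast hn
  have hd : 15 * (7 * (n : ℝ) - 4) ≠ 0 := by
    have : 0 < 7 * (n : ℝ) - 4 := by linarith
    positivity
  rw [fisherBound, div_eq_iff hd] at h
  have hZ : (n : ℤ) * (n + 4) * (2 * n + 1) ^ 2 = m * (15 * (7 * n - 4)) := by exact_mod_cast h
  -- Modulo `7n - 4` one has `7n ≡ 4`, so `7⁴ n (n + 4) (2n + 1)² ≡ 4 · 32 · 15² = 28800`; the cubic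
  -- is the quotient of this division.
  refine ⟨7 ^ 4 * 15 * m - (1372 * n ^ 3 + 7644 * (n : ℤ) ^ 2 + 10199 * n + 7200), ?_⟩
  linear_combination 7 ^ 4 * hZ

theorem fisherBound_ne_int_of_large {n : ℕ} (hn : 8817 ≤ n) : ¬ ∃ m : ℤ, fisherBound n = m := by
  rintro ⟨m, hm⟩
  have := Int.le_of_dvd (by norm_num) (dvd_of_fisherBound_eq_int (by omega) hm)
  omega

theorem two_mul_lt_fisherBound {n : ℕ} (hn : 5 ≤ n) : 2 * (n : ℝ) < fisherBound n := by
  have hN : (5 : ℝ) ≤ n := by exact_mod_cast hn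
  rw [fisherBound, lt_div_iff₀ (by linarith)]
  have h : 0 < ((n : ℝ) + 4) * (2 * n + 1) ^ 2 - 30 * (7 * n - 4) := by
    nlinarith [mul_nonneg (sub_nonneg.2 hN) (sub_nonneg.2 hN),
      mul_nonneg (mul_nonneg (sub_nonneg.2 hN) (sub_nonneg.2 hN)) (sub_nonneg.2 hN)]
  nlinarith [mul_pos (show (0 : ℝ) < n by linarith) h]

theorem one_div_sqrt_zeroSq (n : ℕ) : 1 / √(zeroSq n) = √(2 * ((n : ℝ) + 8) / 15) := by
  rw [zeroSq, one_div, ← Real.sqrt_inv, inv_div]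

theorem not_sqrt_int_and_fisherBound_int {n : ℕ} (hn : 5 ≤ n) :
    ¬ ((∃ m : ℤ, √(2 * ((n : ℝ) + 8) / 15) = m) ∧ ∃ m : ℤ, fisherBound n = m) := by
  rintro ⟨⟨k, hk⟩, m, hm⟩
  have hdvd := dvd_of_fisherBound_eq_int (by omega) hm
  have hsq : 2 * ((n : ℤ) + 8) = 15 * k ^ 2 := by
    have h := Real.sq_sqrt (show 0 ≤ 2 * ((n : ℝ) + 8) / 15 by positivity)
    rw [hk, eq_div_iff (by norm_num)] at h
    have h' : k ^ 2 * 15 = 2 * ((n : ℤ) + 8) := by exact_mod_cast h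
    linarith
  have hk0 : 0 ≤ k := by
    have := Real.sqrt_nonneg (2 * ((n : ℝ) + 8) / 15)
    rw [hk] at this
    exact_mod_cast this
  obtain ⟨j, rfl⟩ : Even k := by
    have : Even (k ^ 2) := by
      have : (15 * k ^ 2) % 2 = 0 := by omega
      exact Int.even_iff.2 (by omega)
    exact (Int.even_pow.1 this).1
  have hnj : (n : ℤ) = 30 * j ^ 2 - 8 := by linarith
  have hj0 : 0 < j := by
    rcases (show 0 ≤ j by omega).eq_or_lt with h | h
    · subst h; omega
    · exact h
  -- With `n = 30 j² - 8`, both `7n - 4 = 30 (7j² - 2)` and `28800 = 30 · 960` lose the factor 30.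
  have hd : 7 * j ^ 2 - 2 ∣ 960 := by
    rw [hnj] at hdvd
    refine (mul_dvd_mul_iff_left (show (30 : ℤ) ≠ 0 by norm_num)).1 ?_
    rwa [show 30 * (7 * j ^ 2 - 2) = 7 * (30 * j ^ 2 - 8) - 4 by ring]
  have hj : j ≤ 11 := by
    have := Int.le_of_dvd (by norm_num) hd
    nlinarith
  interval_cases j <;> norm_num at hd
  -- the remaining case is `j = 1`, that is, `n = 22`
  have hn22 : n = 22 := by omega
  subst hn22
  -- The bound at `n = 22` is `2574/5`.
  norm_num [fisherBound] at hm
  rw [div_eq_iff (by norm_num)] at hm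
  have : (2574 : ℤ) = m * 5 := by exact_mod_cast hm
  omega

theorem not_isTightDesign {n : ℕ} (hn : 3 ≤ n) (Y : Finset (EuclideanSpace ℝ (Fin n))) :
    ¬ IsTightDesign n {6, 2} Y := by
  intro h
  obtain ⟨hY, hcard⟩ := (isTightDesign_iff (by omega)).1 h
  -- The bound exceeds `2n` only from `n = 5` on; for `n = 3, 4` it is `343/85` and `36/5`.
  rcases Nat.lt_or_ge n 5 with h5 | h5
  · interval_cases n
    · norm_num [fisherBound] at hcard
      rw [eq_div_iff (by norm_num)] at hcard
      have : Y.card * 85 = 343 := by exact_mod_cast hcard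
      omega
    · norm_num [fisherBound] at hcard
      rw [eq_div_iff (by norm_num)] at hcard
      have : Y.card * 5 = 36 := by exact_mod_cast hcard
      omega
  · have hlt := two_mul_lt_fisherBound h5
    rw [← hcard] at hlt
    obtain ⟨m, hm⟩ := exists_int_one_div_of_two_mul_lt_card (sqrt_zeroSq_mem n).1.ne' hY.2.1
      ((hY.card_eq_iff (by omega)).1 hcard) (by exact_mod_cast hlt)
    exact not_sqrt_int_and_fisherBound_int h5
      ⟨⟨m, by rw [← one_div_sqrt_zeroSq, hm]⟩, Y.card, by rw [← hcard]; simp⟩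

end HarmonicIndex
theorem mainTheorem8 :
    -- there is no tight design of harmonic index {6,2} for n ≥ 3
    (∀ n : ℕ, 3 ≤ n → ¬ ∃ Y : Finset (EuclideanSpace ℝ (Fin n)),
      HarmonicIndex.IsTightDesign n {6, 2} Y) ∧
    -- for n = 2, the set {(1,0), (0,1)} is tight
    (∃ Y : Finset (EuclideanSpace ℝ (Fin 2)),
      (Y : Set (EuclideanSpace ℝ (Fin 2))) = {!₂[1, 0], !₂[0, 1]} ∧
      HarmonicIndex.IsTightDesign 2 {6, 2} Y) ∧
    -- the Fisher type bound
    (∀ n : ℕ, 2 ≤ n → HarmonicIndex.IsFisherBound n {6, 2}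
      ((n : ℝ) * (n + 4) * (2 * n + 1) ^ 2 / (15 * (7 * n - 4)))) ∧
    -- its extremal combination: the coefficient of Q_{n,2}, the minimum, and where it is attained
    (∀ n : ℕ, 2 ≤ n → ∀ f : ℕ → ℝ, HarmonicIndex.IsFisherFamily n {6, 2} f →
      f 2 = ((n : ℝ) - 2) * (n + 4) * (n + 10) / (32 * (n + 8)) ∧
      HarmonicIndex.IsNegMin n {6, 2} f
        (((n : ℝ) + 2) * (n + 6) * (n + 10) * (7 * n - 4) / (192 * (n + 8))) ∧
      {x : ℝ | x ∈ Set.Icc (-1 : ℝ) 1 ∧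
        IsMinOn (fun u : ℝ => (HarmonicIndex.testPolynomial n {6, 2} f).eval u)
          (Set.Icc (-1) 1) x} =
        {0, √(15 / (2 * ((n : ℝ) + 8))), -√(15 / (2 * ((n : ℝ) + 8)))}) ∧
    -- the Fisher type inequality and its case of equality
    (∀ n : ℕ, 2 ≤ n → ∀ Y : Finset (EuclideanSpace ℝ (Fin n)),
      HarmonicIndex.IsDesign n {6, 2} Y →
      (n : ℝ) * (n + 4) * (2 * n + 1) ^ 2 / (15 * (7 * n - 4)) ≤ (Y.card : ℝ) ∧
      (HarmonicIndex.IsTightDesign n {6, 2} Y ↔ HarmonicIndex.innerProducts Y ⊆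
        {0, √(15 / (2 * ((n : ℝ) + 8))), -√(15 / (2 * ((n : ℝ) + 8)))})) ∧
    -- for n ≥ 8817 the bound is not an integer
    (∀ n : ℕ, 8817 ≤ n → ¬ ∃ m : ℤ,
      (n : ℝ) * (n + 4) * (2 * n + 1) ^ 2 / (15 * (7 * n - 4)) = m) ∧
    -- more than 2n unit vectors with inner products among 0, ±α force 1/α to be an integer
    (∀ (n : ℕ) (α : ℝ) (Y : Finset (EuclideanSpace ℝ (Fin n))), α ≠ 0 →
      (∀ x ∈ Y, ‖x‖ = 1) → HarmonicIndex.innerProducts Y ⊆ {0, α, -α} → 2 * n < Y.card →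
      ∃ m : ℤ, 1 / α = m) ∧
    -- for 5 ≤ n ≤ 8816 the bound exceeds 2n, and it and 1/α are not both integers
    (∀ n : ℕ, 5 ≤ n → n ≤ 8816 →
      2 * (n : ℝ) < (n : ℝ) * (n + 4) * (2 * n + 1) ^ 2 / (15 * (7 * n - 4)) ∧
      1 / √(15 / (2 * ((n : ℝ) + 8))) = √(2 * ((n : ℝ) + 8) / 15) ∧
      ¬ ((∃ m : ℤ, √(2 * ((n : ℝ) + 8) / 15) = m) ∧
        ∃ m : ℤ, (n : ℝ) * (n + 4) * (2 * n + 1) ^ 2 / (15 * (7 * n - 4)) = m)) := by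
  refine ⟨fun n hn ⟨Y, hY⟩ => HarmonicIndex.not_isTightDesign hn Y hY,
    ⟨_, HarmonicIndex.coe_planeBasis, HarmonicIndex.isTightDesign_planeBasis⟩,
    fun n hn => (HarmonicIndex.isFisherBound_iff hn _).2 rfl, fun n hn f hf => ?_,
    fun n hn Y hY => ⟨hY.fisherBound_le hn, ?_⟩,
    fun n hn => HarmonicIndex.fisherBound_ne_int_of_large hn,
    fun n α Y hα hY hI hc => HarmonicIndex.exists_int_one_div_of_two_mul_lt_card hα hY hI hc,
    fun n hn _ => ⟨HarmonicIndex.two_mul_lt_fisherBound hn, HarmonicIndex.one_div_sqrt_zeroSq n,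
      HarmonicIndex.not_sqrt_int_and_fisherBound_int hn⟩⟩
  · have h6 := hf.apply_six
    have h2 := hf.apply_two hn
    refine ⟨h2, HarmonicIndex.extremal_isNegMin hn h6 h2, ?_⟩
    ext x
    rw [Set.mem_ofPred_eq, HarmonicIndex.extremal_isMinOn_iff hn h6 h2]
    refine and_iff_right_of_imp ?_
    obtain ⟨h0, h1⟩ := HarmonicIndex.sqrt_zeroSq_mem n
    rintro (rfl | rfl | rfl) <;> constructor <;> linarith
  · rw [HarmonicIndex.isTightDesign_iff hn, and_iff_right hY]
    exact hY.card_eq_iff hn
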